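/- Let $\theta(z,\tau)=q^{1/8}\,(2\sin\pi z)\prod_{l\ge1}(1-q^l)(1-q^le^{2\pi i z})(1-q^le^{-2\pi i z})$, $q=e^{2\pi i\tau}$, be the Jacobi theta function on $\mathbb C\times\mathcal H$ ($\mathcal H$ the upper half plane). **LG elliptic genus.** Let $G$ be an abelian group with a diagonal representation $R$ on $\mathbb C^n$, $R_i(g)=e^{2\pi i\theta_i(g)}$ with $\theta_i(g)\in\mathbb Q$, which preserves a nonzero polynomial $W(x_1,\dots,x_n)$ that is weighted homogeneous of degree $D\ge1$ for integer weights $w_1,\dots,w_n\ge1$; put $q_i=w_i/D$. For a finite subgroup $H\subseteq G$ the LG elliptic genus is $$Z[R,H](z,\tau)=\frac1{|H|}\sum_{h_a,h_b\in H}\ \prod_{i=1}^n e^{-2\pi i\,\theta_i(h_a)z}\,\frac{\theta\big((1-q_i)z-\theta_i(h_b)-\tau\theta_i(h_a),\tau\big)}{\theta\big(q_iz+\theta_i(h_b)+\tau\theta_i(h_a),\tau\big)} .$$ Let $J_W=\mathrm{diag}(e^{2\pi i q_1},\dots,e^{2\pi i q_n})$ be the exponential grading operator. **Landau–Ginzburg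 phase.** Let $\mathbb C^*$ act on the total space $\mathbb C\times\mathbb C^n$ of the trivial line bundle over $\mathbb C^n$ by $\lambda(p,x_1,\dots,x_n)=(\lambda^{-D}p,\lambda^{w_1}x_1,\dots,\lambda^{w_n}x_n)$, linearized by $\kappa(\lambda)=\lambda^k$ with $k<0$. The semistable locus is $\{p\neq0\}$, and $x\mapsto[1,x]$ presents the GIT quotient (the phase) as $\mathbb C^n/\langle J_W\rangle$. The torus $T=\mathbb C^*$ acting by $s[p,x]=[sp,x]$ acts faithfully on the phase; its action lifts to the action of the $D$-fold cover of $T$ on $\mathbb C^n$ with weights $w_1,\dots,w_n$, whose only fixed point is the origin. If $u$ is the generating infinitesimal character of $T$, the equivariant Chern roots of the lifted action at the origin are $x_i=2\pi i\,\frac{w_i}{D}u$. The elliptic genus of the phase, $\mathrm{Ell}(z,\tau)$, is the contribution of the origin, given by localization, to the $T$-equivariant orbifold elliptic genus of $(\mathbb C^n,\Gamma)$, $\Gamma=\langle J_W\rangle$, restricted to $u=z$: $$\mathrm{Ell}(z,\tau)=\frac1{|\Gamma|}\sum_{g,h\in\Gamma}\frac{\displaystyle\prod_{i\,:\,(g_i,h_i)\ne(1,1)}\!\!x_i\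 \prod_{i\,:\,g_i=h_i=1}\!\!x_i\ \prod_{i=1}^n\frac{\theta\big(\frac{x_i}{2\pi i}+\lambda_i(g)-\tau\lambda_i(h)-z,\tau\big)}{\theta\big(\frac{x_i}{2\pi i}+\lambda_i(g)-\tau\lambda_i(h),\tau\big)}e^{2\pi i\lambda_i(h)z}}{\prod_{i=1}^n x_i}\Bigg|_{u=z},$$ where $g_i=e^{2\pi i\lambda_i(g)}$ with $0\le\lambda_i(g)<1$ (the first product comes from the Gysin map of the fixed space of $g,h$, and the denominator is the equivariant Euler class of the tangent space at the origin). **Proposition.** Suppose that $R$ maps $H$ isomorphically onto $\langle J_W\rangle$. Then the elliptic genus of the Landau–Ginzburg phase coincides with the LG elliptic genus, up to the sign $(-1)^n$ that comes from the normalization of the latter: for all $\tau\in\mathcal H$, $$\mathrm{Ell}(z,\tau)=(-1)^n\,Z[R,H](z,\tau)$$ as meromorphic functions of $z$ (pointwise for every $z\ne0$, a summand being read as $0$ where one of its denominators vanishes). -/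

import Mathlib

open scoped UpperHalfPlane

noncomputable section

/-! ### The theta function -/

/-- The Jacobi theta function
`θ(z,τ) = q^{1/8} (2 sin πz) ∏_{l ≥ 1} (1-q^l)(1-q^l e^{2πiz})(1-q^l e^{-2πiz})`, `q = e^{2πiτ}`,
in its series form `-∑_{m ∈ ℤ} exp(πi (m+1/2)² τ + 2πi (m+1/2)(z+1/2))`, which is written through
Mathlib's two-variable theta function `∑_{m ∈ ℤ} exp(2πi m z + πi m² τ)`. It is odd in `z`. -/
def jacobiThetaOne (z τ : ℂ) : ℂ :=
  -Complex.exp (Real.pi * Complex.I * (τ / 4 + z + 1 / 2)) * jacobiTheta₂ (z + 1 / 2 + τ / 2) τ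

/-! ### The GIT problem and its phases -/

/-- The action `t • (p, x) = (t^{-D} p, t^{w_1} x_1, …, t^{w_n} x_n)` of `G = ℂˣ` on the total space
`ℂ × ℂⁿ` of the trivial line bundle over `ℂⁿ`. -/
def gaugeAct {n : ℕ} (w : Fin n → ℕ) (D : ℕ) (t : ℂˣ) (v : ℂ × (Fin n → ℂ)) : ℂ × (Fin n → ℂ) :=
  (((t⁻¹ ^ D : ℂˣ) : ℂ) * v.1, fun i => (t : ℂ) ^ w i * v.2 i)

theorem gaugeAct_one {n : ℕ} (w : Fin n → ℕ) (D : ℕ) (v : ℂ × (Fin n → ℂ)) :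
    gaugeAct w D 1 v = v := by
  simp [gaugeAct]

theorem gaugeAct_mul {n : ℕ} (w : Fin n → ℕ) (D : ℕ) (s t : ℂˣ) (v : ℂ × (Fin n → ℂ)) :
    gaugeAct w D (s * t) v = gaugeAct w D s (gaugeAct w D t v) := by
  ext
  · simp [gaugeAct]; ring
  · simp [gaugeAct, mul_pow]; ring

/-- The value of a polynomial in `p, x_1, …, x_n` at a point of `ℂ × ℂⁿ`. The coordinate `p` has
index `none` and `x_i` has index `some i`. -/
def evalAt {n : ℕ} (f : MvPolynomial (Option (Fin n)) ℂ) (v : ℂ × (Fin n → ℂ)) : ℂ :=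
  MvPolynomial.eval (fun o => o.elim v.1 v.2) f

/-- The semistable locus for the linearization `κ(t) = t^k` of the trivial bundle on `ℂ × ℂⁿ`: the
points at which some invariant section of a positive power of the linearized bundle does not vanish
(the nonvanishing locus of a section is automatically affine here). -/
def semistableLocus {n : ℕ} (w : Fin n → ℕ) (D : ℕ) (k : ℤ) : Set (ℂ × (Fin n → ℂ)) :=
  {v | ∃ m : ℕ, 0 < m ∧ ∃ f : MvPolynomial (Option (Fin n)) ℂ,
    (∀ (t : ℂˣ) (u : ℂ × (Fin n → ℂ)),
      evalAt f (gaugeAct w D t u) = ((t ^ (k * m) : ℂˣ) : ℂ) * evalAt f u) ∧ evalAt f v ≠ 0}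

/-- Two semistable points are equivalent if they lie on the same orbit. -/
def phaseSetoid {n : ℕ} (w : Fin n → ℕ) (D : ℕ) (k : ℤ) : Setoid (semistableLocus w D k) where
  r u v := ∃ t : ℂˣ, gaugeAct w D t u.1 = v.1
  iseqv :=
    { refl := fun u => ⟨1, gaugeAct_one w D u.1⟩
      symm := by
        rintro u v ⟨t, h⟩
        exact ⟨t⁻¹, by rw [← h, ← gaugeAct_mul, inv_mul_cancel, gaugeAct_one]⟩
      trans := by
        rintro a b c ⟨t, h⟩ ⟨s, h'⟩
        exact ⟨s * t, by rw [gaugeAct_mul, h, h']⟩ }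

/-- The phase: the quotient of the semistable locus by `ℂˣ`. It is used for `k ≠ 0` and positive
weights; then every semistable point is stable, so that the GIT quotient is the orbit space. -/
def Phase {n : ℕ} (w : Fin n → ℕ) (D : ℕ) (k : ℤ) : Type := Quotient (phaseSetoid w D k)

/-- The class of a semistable point in the phase. -/
def Phase.mk {n : ℕ} {w : Fin n → ℕ} {D : ℕ} {k : ℤ} (v : semistableLocus w D k) : Phase w D k :=
  Quotient.mk (phaseSetoid w D k) v

/-- The phase carries the quotient topology. -/
instance {n : ℕ} (w : Fin n → ℕ) (D : ℕ) (k : ℤ) : TopologicalSpace (Phase w D k) :=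
  inferInstanceAs (TopologicalSpace (Quotient (phaseSetoid w D k)))

/-- A function on the phase is holomorphic on the open set `U` if its pull-back to the semistable
locus is holomorphic on the preimage of `U`. -/
def Phase.HolomorphicOn {n : ℕ} {w : Fin n → ℕ} {D : ℕ} {k : ℤ} (F : Phase w D k → ℂ)
    (U : Set (Phase w D k)) : Prop :=
  ∃ Fhat : ℂ × (Fin n → ℂ) → ℂ, (∀ v : semistableLocus w D k, Fhat v = F (Phase.mk v)) ∧
    DifferentiableOn ℂ Fhat {v | ∃ h : v ∈ semistableLocus w D k, Phase.mk ⟨v, h⟩ ∈ U}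

/-- Fibrewise scaling of the line bundle preserves the semistable locus. -/
theorem semistableLocus_scale {n : ℕ} {w : Fin n → ℕ} {D : ℕ} {k : ℤ} (s : ℂˣ)
    {v : ℂ × (Fin n → ℂ)} (hv : v ∈ semistableLocus w D k) :
    ((s : ℂ) * v.1, v.2) ∈ semistableLocus w D k := by
  obtain ⟨m, hm, f, hf, hne⟩ := hv
  let σ : Option (Fin n) → MvPolynomial (Option (Fin n)) ℂ := fun o =>
    o.elim (MvPolynomial.C ((s⁻¹ : ℂˣ) : ℂ) * MvPolynomial.X none) (fun i => MvPolynomial.X (some i))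
  have key : ∀ u : ℂ × (Fin n → ℂ),
      evalAt (MvPolynomial.bind₁ σ f) u = evalAt f (((s⁻¹ : ℂˣ) : ℂ) * u.1, u.2) := by
    intro u
    unfold evalAt
    rw [← MvPolynomial.coe_aeval_eq_eval, ← MvPolynomial.coe_aeval_eq_eval]
    simp only [RingHom.coe_coe, MvPolynomial.aeval_bind₁]
    congr 2
    funext o
    cases o <;> simp [σ]
  refine ⟨m, hm, MvPolynomial.bind₁ σ f, ?_, ?_⟩
  · intro t u
    rw [key, key, ← hf]
    congr 1
    ext
    · simp [gaugeAct]; ring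
    · simp [gaugeAct]
  · rw [key]
    simpa using hne

/-- The `ℂˣ`-action on the phase that is induced by scaling the fibres of the line bundle. -/
instance {n : ℕ} (w : Fin n → ℕ) (D : ℕ) (k : ℤ) : MulAction ℂˣ (Phase w D k) where
  smul s := Quotient.map' (s₁ := phaseSetoid w D k) (s₂ := phaseSetoid w D k)
    (fun v => ⟨((s : ℂ) * v.1.1, v.1.2), semistableLocus_scale s v.2⟩) (by
      rintro u v ⟨t, h⟩
      refine ⟨t, ?_⟩
      dsimp only
      rw [← h]
      ext
      · simp [gaugeAct]; ring
      · simp [gaugeAct])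
  one_smul := by
    rintro ⟨v⟩
    refine Quotient.sound' ⟨1, ?_⟩
    simp [gaugeAct_one]
  mul_smul := by
    rintro s t ⟨v⟩
    refine Quotient.sound' ⟨1, ?_⟩
    simp [gaugeAct_one, mul_assoc]

theorem Phase.smul_mk {n : ℕ} {w : Fin n → ℕ} {D : ℕ} {k : ℤ} (s : ℂˣ)
    (v : semistableLocus w D k) :
    s • Phase.mk v = Phase.mk ⟨((s : ℂ) * v.1.1, v.1.2), semistableLocus_scale s v.2⟩ := rfl

/-! ### Global quotient presentations and the elliptic genus of a phase -/

/-- A presentation of the phase as a global quotient `ℂⁿ/Γ` by a finite diagonal group `Γ`, with a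
lift of the `T = ℂˣ`-action on the phase to a linear action on `ℂⁿ` of a finite cover `T̃ = ℂˣ → T`,
`σ ↦ σ^d`, of which the origin of `ℂⁿ` is the only fixed point. -/
structure GlobalQuotient {n : ℕ} (w : Fin n → ℕ) (D : ℕ) (k : ℤ) where
  /-- the orbifold group, acting on `ℂⁿ` coordinatewise -/
  Γ : Subgroup (Fin n → ℂˣ)
  finite : Finite Γ
  /-- the quotient map -/
  π : (Fin n → ℂ) → Phase w D k
  isQuotientMap : Topology.IsQuotientMap π
  fibre : ∀ x y, π x = π y ↔ ∃ g ∈ Γ, g • x = y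
  holomorphic : ∀ (U : Set (Phase w D k)) (F : Phase w D k → ℂ), IsOpen U →
    (Phase.HolomorphicOn F U ↔ DifferentiableOn ℂ (F ∘ π) (π ⁻¹' U))
  faithful : ∀ s : ℂˣ, (∀ y : Phase w D k, s • y = y) → s = 1
  /-- the degree of the cover of tori -/
  d : ℕ
  d_pos : 0 < d
  /-- the weights of the lifted action -/
  weight : Fin n → ℤ
  lift : ∀ (σ : ℂˣ) x, π ((fun i => σ ^ weight i) • x) = σ ^ d • π x
  fixed : ∀ x : Fin n → ℂ, (∀ σ : ℂˣ, (fun i => σ ^ weight i) • x = x) ↔ x = 0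

/-- The logarithm `λ ∈ [0,1)` of a value `c = e^{2πiλ}` of a character of a finite group. -/
def logChar (c : ℂˣ) : ℝ := Int.fract (Complex.arg c / (2 * Real.pi))

namespace GlobalQuotient

variable {n : ℕ} {w : Fin n → ℕ} {D : ℕ} {k : ℤ}

/-- The equivariant Chern root at the origin of the `i`-th coordinate line of `ℂⁿ`, divided by `2πi`:
the infinitesimal character of the lifted action on it, expressed through the infinitesimal
character `u` of the torus `T` acting faithfully on the phase (`u` pulls back to `d` times
the generator for `T̃`). -/
def infChar (Q : GlobalQuotient w D k) (u : ℂ) (i : Fin n) : ℂ :=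
  ((Q.weight i : ℂ) / (Q.d : ℂ)) * u

/-- The equivariant Chern root at the origin of the `i`-th coordinate line of `ℂⁿ`. -/
def chernRoot (Q : GlobalQuotient w D k) (u : ℂ) (i : Fin n) : ℂ :=
  2 * Real.pi * Complex.I * Q.infChar u i

/-- The restriction to the origin of the summand of the equivariant orbifold elliptic class of
`(ℂⁿ, Γ)` for the pair `(g, h)`. The coordinate lines are eigenspaces of `⟨g, h⟩`; the fixed space
of `g, h` is spanned by those with `λ(g) = λ(h) = 0`, so that the Gysin map from the fixed space
followed by restriction to the origin multiplies by the product of the other Chern roots. -/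
def sector (Q : GlobalQuotient w D k) (g h : Fin n → ℂˣ) (u z : ℂ) (τ : ℍ) : ℂ :=
  open Classical in
  (∏ i with ¬(logChar (g i) = 0 ∧ logChar (h i) = 0), Q.chernRoot u i) *
  ((∏ i with logChar (g i) = 0 ∧ logChar (h i) = 0, Q.chernRoot u i) *
    ∏ i, (jacobiThetaOne (Q.chernRoot u i / (2 * Real.pi * Complex.I) + logChar (g i)
            - τ * logChar (h i) - z) τ /
          jacobiThetaOne (Q.chernRoot u i / (2 * Real.pi * Complex.I) + logChar (g i)
            - τ * logChar (h i)) τ *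
          Complex.exp (2 * Real.pi * Complex.I * logChar (h i) * z)))

/-- The contribution of the fixed point `0 ∈ ℂⁿ` to the equivariant orbifold elliptic genus, by
localization: the restriction of the class to the fixed point divided by the equivariant Euler class
of the tangent space. -/
def originContribution (Q : GlobalQuotient w D k) (u z : ℂ) (τ : ℍ) : ℂ :=
  (1 / (Nat.card Q.Γ : ℂ)) *
    ∑ᶠ (g : Q.Γ) (h : Q.Γ), Q.sector g.1 h.1 u z τ / ∏ i, Q.chernRoot u i

/-- The elliptic genus of the phase relative to the origin: the restriction of the contribution of
the origin to the diagonal `u = z`. -/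
def ellipticGenus (Q : GlobalQuotient w D k) (z : ℂ) (τ : ℍ) : ℂ :=
  Q.originContribution z z τ

end GlobalQuotient

/-! ### Landau-Ginzburg data and the LG elliptic genus -/

/-- The data entering the LG elliptic genus: a diagonal representation `R` of an abelian group `G` on
`ℂⁿ` with rational logarithms `θ_i(g)`, preserving a nonzero weighted homogeneous polynomial `W`
with positive weights `w_i` and positive degree `D`. -/
structure LGData (n : ℕ) (G : Type*) [CommGroup G] where
  R : G →* (Fin n → ℂˣ)
  logR : G → Fin n → ℚ
  exp_logR : ∀ g i, ((R g i : ℂˣ) : ℂ) = Complex.exp (2 * Real.pi * Complex.I * (logR g i : ℂ))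
  w : Fin n → ℕ
  D : ℕ
  w_pos : ∀ i, 0 < w i
  D_pos : 0 < D
  W : MvPolynomial (Fin n) ℂ
  W_ne_zero : W ≠ 0
  homogeneous : MvPolynomial.IsWeightedHomogeneous w W D
  invariant : ∀ (g : G) (x : Fin n → ℂ), MvPolynomial.eval (R g • x) W = MvPolynomial.eval x W

namespace LGData

variable {n : ℕ} {G : Type*} [CommGroup G]

/-- The numbers `q_i = w_i / D`. -/
def q (L : LGData n G) (i : Fin n) : ℚ := (L.w i : ℚ) / (L.D : ℚ)

/-- The factor `Z[R_i](h_a, h_b)`. -/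
def factor (L : LGData n G) (i : Fin n) (a b : G) (z : ℂ) (τ : ℍ) : ℂ :=
  Complex.exp (-2 * Real.pi * Complex.I * (L.logR a i : ℂ) * z) *
    (jacobiThetaOne ((1 - (L.q i : ℂ)) * z - (L.logR b i : ℂ) - τ * (L.logR a i : ℂ)) τ /
      jacobiThetaOne ((L.q i : ℂ) * z + (L.logR b i : ℂ) + τ * (L.logR a i : ℂ)) τ)

/-- The LG elliptic genus `Z[R,H]`, for a finite subgroup `H`. -/
def genus (L : LGData n G) (H : Subgroup G) (z : ℂ) (τ : ℍ) : ℂ :=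
  (1 / (Nat.card H : ℂ)) * ∑ᶠ (a : H) (b : H), ∏ i, L.factor i a.1 b.1 z τ

/-- The exponential grading operator `J_W = (e^{2πi q_1}, …, e^{2πi q_n})`. -/
def J (L : LGData n G) : Fin n → ℂˣ := fun i =>
  Units.mk0 (Complex.exp (2 * Real.pi * Complex.I * (L.q i : ℂ))) (Complex.exp_ne_zero _)

end LGData

/-! ### The Landau-Ginzburg phase -/

/-- For `k < 0` the unstable locus is the hyperplane `p = 0`. -/
theorem mem_semistableLocus_iff {n : ℕ} {w : Fin n → ℕ} {D : ℕ} {k : ℤ}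
    (hD : 0 < D) (hk : k < 0) (v : ℂ × (Fin n → ℂ)) :
    v ∈ semistableLocus w D k ↔ v.1 ≠ 0 := by
  obtain ⟨a, rfl⟩ : ∃ a : ℕ, k = -(a : ℤ) := ⟨k.natAbs, by omega⟩
  have ha : 0 < a := by omega
  constructor
  · rintro ⟨m, hm, f, hf, hne⟩ hp
    apply hne
    have hcont : Continuous fun t : ℂ =>
        t ^ (a * m) * MvPolynomial.eval
          (fun o : Option (Fin n) => o.elim (0 : ℂ) (fun i => t ^ w i * v.2 i)) f := by
      refine (continuous_pow _).mul ?_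
      refine (MvPolynomial.continuous_eval f).comp (continuous_pi fun o => ?_)
      cases o
      · exact continuous_const
      · exact (continuous_pow _).mul continuous_const
    have hval : ∀ t : ℂ, t ≠ 0 → t ^ (a * m) * MvPolynomial.eval
          (fun o : Option (Fin n) => o.elim (0 : ℂ) (fun i => t ^ w i * v.2 i)) f
          = evalAt f v := by
      intro t ht
      have h := hf (Units.mk0 t ht) v
      have e : evalAt f (gaugeAct w D (Units.mk0 t ht) v) = MvPolynomial.eval
          (fun o : Option (Fin n) => o.elim (0 : ℂ) (fun i => t ^ w i * v.2 i)) f := by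
        simp [evalAt, gaugeAct, hp]
      rw [← e, h]
      have : (((Units.mk0 t ht) ^ (-(a : ℤ) * m) : ℂˣ) : ℂ) = (t ^ (a * m))⁻¹ := by
        rw [neg_mul, zpow_neg, Units.val_inv_eq_inv_val]
        congr 1
      rw [this, mul_inv_cancel_left₀ (pow_ne_zero _ ht)]
    have h1 := (hcont.tendsto 0).mono_left (nhdsWithin_le_nhds (s := {0}ᶜ))
    have h2 : Filter.Tendsto (fun t : ℂ =>
        t ^ (a * m) * MvPolynomial.eval
          (fun o : Option (Fin n) => o.elim (0 : ℂ) (fun i => t ^ w i * v.2 i)) f)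
        (nhdsWithin 0 {0}ᶜ) (nhds (evalAt f v)) := by
      refine tendsto_const_nhds.congr' ?_
      filter_upwards [self_mem_nhdsWithin] with t ht using (hval t ht).symm
    have h3 := tendsto_nhds_unique h2 h1
    rw [h3, zero_pow (Nat.mul_pos ha hm).ne', zero_mul]
  · intro hp
    refine ⟨D, hD, MvPolynomial.X none ^ a, ?_, ?_⟩
    · intro t u
      simp only [evalAt, gaugeAct, map_pow, MvPolynomial.eval_X, Option.elim, mul_pow]
      congr 1
      rw [← Units.val_pow_eq_pow_val]
      congr 1
      rw [neg_mul, zpow_neg, mul_comm, ← pow_mul, inv_pow]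
      norm_cast
    · simpa [evalAt] using pow_ne_zero a hp

namespace LGData

variable {n : ℕ} {G : Type*} [CommGroup G]

/-- The map `ℂⁿ → (ℂ × ℂⁿ)//ℂˣ`, `x ↦ [1, x]`. -/
def toPhase (L : LGData n G) {k : ℤ} (hk : k < 0) (x : Fin n → ℂ) : Phase L.w L.D k :=
  Phase.mk ⟨(1, x), (mem_semistableLocus_iff L.D_pos hk _).2 one_ne_zero⟩

theorem J_pow_D (L : LGData n G) : L.J ^ L.D = 1 := by
  ext i
  have hD : (L.D : ℂ) ≠ 0 := by exact_mod_cast L.D_pos.ne'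
  simp only [J, q, Pi.pow_apply, Units.val_pow_eq_pow_val, Units.val_mk0, Pi.one_apply,
    Units.val_one]
  rw [← Complex.exp_nat_mul, Complex.exp_eq_one_iff]
  refine ⟨L.w i, ?_⟩
  push_cast
  field_simp

theorem J_zpow_apply (L : LGData n G) (j : ℤ) (i : Fin n) :
    (((L.J ^ j) i : ℂˣ) : ℂ) = Complex.exp (2 * Real.pi * Complex.I * j / L.D) ^ L.w i := by
  have hD : (L.D : ℂ) ≠ 0 := by exact_mod_cast L.D_pos.ne'
  simp only [J, q, Pi.pow_apply, Units.val_zpow_eq_zpow_val, Units.val_mk0]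
  rw [← Complex.exp_int_mul, ← Complex.exp_nat_mul]
  congr 1
  push_cast
  field_simp

theorem toPhase_eq_iff (L : LGData n G) {k : ℤ} (hk : k < 0) (x y : Fin n → ℂ) :
    L.toPhase hk x = L.toPhase hk y ↔ ∃ g ∈ Subgroup.zpowers L.J, g • x = y := by
  have hD : (L.D : ℂ) ≠ 0 := by exact_mod_cast L.D_pos.ne'
  have h0 : L.toPhase hk x = L.toPhase hk y ↔ ∃ t : ℂˣ, gaugeAct L.w L.D t (1, x) = (1, y) :=
    Quotient.eq (r := phaseSetoid L.w L.D k)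
  rw [h0]
  constructor
  · rintro ⟨t, h⟩
    have h1 : (t : ℂ) ^ L.D = 1 := by
      have := congrArg Prod.fst h
      simpa [gaugeAct] using this
    have hprim := Complex.isPrimitiveRoot_exp L.D L.D_pos.ne'
    have : NeZero L.D := ⟨L.D_pos.ne'⟩
    obtain ⟨j, -, hj⟩ := hprim.eq_pow_of_pow_eq_one h1
    refine ⟨L.J ^ (j : ℤ), ⟨j, rfl⟩, ?_⟩
    funext i
    have h2 := congrFun (congrArg Prod.snd h) i
    simp only [gaugeAct] at h2
    have h3 : Complex.exp (2 * Real.pi * Complex.I * ((j : ℤ) : ℂ) / L.D) = t := by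
      rw [← hj, ← Complex.exp_nat_mul]
      congr 1
      push_cast
      ring
    rw [← h2, Pi.smul_apply', Units.smul_def, J_zpow_apply, h3, smul_eq_mul]
  · rintro ⟨_, ⟨j, rfl⟩, rfl⟩
    refine ⟨Units.mk0 (Complex.exp (2 * Real.pi * Complex.I * j / L.D)) (Complex.exp_ne_zero _), ?_⟩
    ext i
    · simp only [gaugeAct, Units.val_pow_eq_pow_val, Units.val_inv_eq_inv_val, Units.val_mk0,
        mul_one, inv_pow]
      rw [← Complex.exp_nat_mul, inv_eq_one, Complex.exp_eq_one_iff]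
      exact ⟨j, by field_simp⟩
    · simp only [gaugeAct, Units.val_mk0]
      rw [Pi.smul_apply', Units.smul_def]
      exact congrArg (· * x i) (L.J_zpow_apply j i).symm

/-- Moving a point of the semistable locus to the slice `p = 1`. -/
theorem mk_eq_toPhase (L : LGData n G) {k : ℤ} (hk : k < 0) (v : semistableLocus L.w L.D k)
    {r : ℂ} (hr : r ^ L.D = v.1.1) :
    Phase.mk v = L.toPhase hk (fun i => r ^ L.w i * v.1.2 i) := by
  have hp := (mem_semistableLocus_iff L.D_pos hk v.1).1 v.2
  have hr0 : r ≠ 0 := by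
    rintro rfl
    rw [zero_pow L.D_pos.ne'] at hr
    exact hp hr.symm
  refine Quotient.sound (s := phaseSetoid L.w L.D k) ⟨Units.mk0 r hr0, ?_⟩
  ext
  · simp [gaugeAct, hr, hp]
  · simp [gaugeAct]

/-- Holomorphic local branches of the `D`-th root. -/
theorem exists_root_branch {D : ℕ} (hD : 0 < D) {p₀ : ℂ} (hp : p₀ ≠ 0) :
    ∃ r : ℂ → ℂ, DifferentiableAt ℂ r p₀ ∧ ∀ p, p ≠ 0 → r p ^ D = p := by
  obtain ⟨c, hc⟩ := IsAlgClosed.exists_pow_nat_eq p₀ hD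
  have hD' : (D : ℂ) ≠ 0 := by exact_mod_cast hD.ne'
  refine ⟨fun p => c * Complex.exp (Complex.log (p / p₀) / D), ?_, ?_⟩
  · have h1 : DifferentiableAt ℂ (fun p : ℂ => p / p₀) p₀ := by fun_prop
    have h2 : p₀ / p₀ ∈ Complex.slitPlane := by
      rw [div_self hp]; exact Complex.one_mem_slitPlane
    exact ((h1.clog h2).div_const _).cexp.const_mul _
  · intro p hp'
    rw [mul_pow, hc, ← Complex.exp_nat_mul, mul_div_cancel₀ _ hD',
      Complex.exp_log (div_ne_zero hp' hp)]
    field_simp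

theorem continuous_toPhase (L : LGData n G) {k : ℤ} (hk : k < 0) : Continuous (L.toPhase hk) := by
  refine (continuous_quotient_mk' (s := phaseSetoid L.w L.D k)).comp ?_
  exact Continuous.subtype_mk (by fun_prop) _

theorem slice_differentiableAt (w : Fin n → ℕ) {r : ℂ → ℂ} {v₀ : ℂ × (Fin n → ℂ)}
    (hr : DifferentiableAt ℂ r v₀.1) :
    DifferentiableAt ℂ (fun v : ℂ × (Fin n → ℂ) => fun i => r v.1 ^ w i * v.2 i) v₀ := by
  refine differentiableAt_pi.2 fun i => ?_
  have h1 : DifferentiableAt ℂ (fun v : ℂ × (Fin n → ℂ) => r v.1) v₀ :=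
    DifferentiableAt.comp v₀ hr differentiableAt_fst
  have h2 : DifferentiableAt ℂ (fun v : ℂ × (Fin n → ℂ) => v.2 i) v₀ := by fun_prop
  exact (h1.pow _).mul h2

theorem isQuotientMap_toPhase (L : LGData n G) {k : ℤ} (hk : k < 0) :
    Topology.IsQuotientMap (L.toPhase hk) := by
  rw [Topology.isQuotientMap_iff]
  refine ⟨.of_isOpen_preimage_iff_isOpen fun U =>
    ⟨fun h => ?_, fun h => h.preimage (L.continuous_toPhase hk)⟩, ?_⟩
  rotate_left
  · rintro ⟨v⟩
    obtain ⟨r, hr⟩ := IsAlgClosed.exists_pow_nat_eq v.1.1 L.D_pos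
    exact ⟨_, (L.mk_eq_toPhase hk v hr).symm⟩
  · change IsOpen ((Phase.mk : semistableLocus L.w L.D k → _) ⁻¹' U)
    rw [isOpen_iff_mem_nhds]
    intro v₀ hv₀
    have hp := (mem_semistableLocus_iff L.D_pos hk v₀.1).1 v₀.2
    obtain ⟨r, hrd, hr⟩ := exists_root_branch L.D_pos hp
    have hc : ContinuousAt (fun v : semistableLocus L.w L.D k =>
        (fun i => r v.1.1 ^ L.w i * v.1.2 i : Fin n → ℂ)) v₀ :=
      ContinuousAt.comp (f := Subtype.val) (slice_differentiableAt L.w hrd).continuousAt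
        continuous_subtype_val.continuousAt
    have hmem : (fun i => r v₀.1.1 ^ L.w i * v₀.1.2 i) ∈ L.toPhase hk ⁻¹' U := by
      rw [Set.mem_preimage, ← L.mk_eq_toPhase hk v₀ (hr _ hp)]
      exact hv₀
    filter_upwards [hc.preimage_mem_nhds (h.mem_nhds hmem)] with v hv
    have hpv := (mem_semistableLocus_iff L.D_pos hk v.1).1 v.2
    rw [Set.mem_preimage, L.mk_eq_toPhase hk v (hr _ hpv)]
    exact hv

theorem holomorphic_toPhase (L : LGData n G) {k : ℤ} (hk : k < 0) (U : Set (Phase L.w L.D k))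
    (F : Phase L.w L.D k → ℂ) (hU : IsOpen U) :
    Phase.HolomorphicOn F U ↔
      DifferentiableOn ℂ (F ∘ L.toPhase hk) (L.toPhase hk ⁻¹' U) := by
  classical
  constructor
  · rintro ⟨Fhat, h1, h2⟩
    have h3 : F ∘ L.toPhase hk = Fhat ∘ fun x => ((1 : ℂ), x) := by
      funext x
      exact (h1 ⟨(1, x), (mem_semistableLocus_iff L.D_pos hk _).2 one_ne_zero⟩).symm
    rw [h3]
    refine h2.comp (by fun_prop) ?_
    intro x hx
    exact ⟨(mem_semistableLocus_iff L.D_pos hk _).2 one_ne_zero, hx⟩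
  · intro h
    refine ⟨fun v => if hv : v ∈ semistableLocus L.w L.D k then F (Phase.mk ⟨v, hv⟩) else 0,
      fun v => by simp, ?_⟩
    rintro v₀ ⟨hv₀, hmem⟩
    refine DifferentiableAt.differentiableWithinAt ?_
    have hp := (mem_semistableLocus_iff L.D_pos hk v₀).1 hv₀
    obtain ⟨r, hrd, hr⟩ := exists_root_branch L.D_pos hp
    have hmem' : (fun i => r v₀.1 ^ L.w i * v₀.2 i) ∈ L.toPhase hk ⁻¹' U := by
      rw [Set.mem_preimage, ← L.mk_eq_toPhase hk ⟨v₀, hv₀⟩ (hr _ hp)]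
      exact hmem
    have hd := (h.differentiableAt
      ((hU.preimage (L.continuous_toPhase hk)).mem_nhds hmem')).comp v₀
      (slice_differentiableAt L.w hrd)
    refine hd.congr_of_eventuallyEq ?_
    have hnear : ∀ᶠ v : ℂ × (Fin n → ℂ) in nhds v₀, v.1 ≠ 0 :=
      continuous_fst.continuousAt.eventually_ne hp
    filter_upwards [hnear] with v hv
    have hvs := (mem_semistableLocus_iff (w := L.w) L.D_pos hk v).2 hv
    rw [dif_pos hvs, L.mk_eq_toPhase hk ⟨v, hvs⟩ (hr _ hv)]
    rfl

/-- The Landau-Ginzburg phase (`k < 0`) presented as `ℂⁿ/⟨J_W⟩` by the map `x ↦ [1, x]`. The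
`T`-action `s • [p, x] = [s p, x]` lifts to the action of the `D`-fold cover of `T` with weights
`w_1, …, w_n`. -/
def presentation (L : LGData n G) {k : ℤ} (hk : k < 0) : GlobalQuotient L.w L.D k where
  Γ := Subgroup.zpowers L.J
  finite := by
    rw [← Nat.card_pos_iff.trans (and_iff_right ⟨1⟩), Nat.card_zpowers]
    exact (isOfFinOrder_iff_pow_eq_one.2 ⟨L.D, L.D_pos, L.J_pow_D⟩).orderOf_pos
  π := L.toPhase hk
  isQuotientMap := L.isQuotientMap_toPhase hk
  fibre := L.toPhase_eq_iff hk
  holomorphic := L.holomorphic_toPhase hk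
  faithful := by
    intro s hs
    have h := Quotient.exact (s := phaseSetoid L.w L.D k) (hs (L.toPhase hk 1))
    obtain ⟨t, ht⟩ := h
    have h1 := congrArg Prod.fst ht
    have h2 := fun i => congrFun (congrArg Prod.snd ht) i
    simp only [gaugeAct, Pi.one_apply, mul_one, inv_pow, Units.val_inv_eq_inv_val,
      Units.val_pow_eq_pow_val] at h1 h2
    obtain ⟨a, ha⟩ := MvPolynomial.ne_zero_iff.1 L.W_ne_zero
    have hdeg := L.homogeneous ha
    have h3 : (t : ℂ) ^ L.D = 1 := by
      rw [← hdeg, Finsupp.weight_apply, Finsupp.sum, ← Finset.prod_pow_eq_pow_sum]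
      refine Finset.prod_eq_one fun i _ => ?_
      rw [smul_eq_mul, mul_comm, pow_mul, h2, one_pow]
    rw [h3] at h1
    ext
    simpa using h1
  d := L.D
  d_pos := L.D_pos
  weight := fun i => L.w i
  lift := by
    intro σ x
    refine (Quotient.sound (s := phaseSetoid L.w L.D k) ⟨σ, ?_⟩).symm
    ext i
    · simp [gaugeAct]
    · simp [gaugeAct, Units.smul_def]
  fixed := by
    intro x
    constructor
    · intro h
      funext i
      have h2 := congrFun (h (Units.mk0 2 two_ne_zero)) i
      simp only [Pi.smul_apply', Units.smul_def, zpow_natCast, Units.val_pow_eq_pow_val,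
        Units.val_mk0, smul_eq_mul] at h2
      by_contra hx
      have h3 : (2 : ℂ) ^ L.w i = 1 := mul_right_cancel₀ hx (h2.trans (one_mul _).symm)
      have h4 : (2 : ℕ) ^ L.w i = 1 := by exact_mod_cast h3
      exact (Nat.one_lt_two_pow (L.w_pos i).ne').ne' h4
    · rintro rfl σ
      exact smul_zero _

end LGData

end

/-! The two double sums agree term by term once the pair $(h_a,h_b)$ of the LG genus is matched with
$(g,h)=(R(h_b),R(h_a)^{-1})$; the inverse is needed because the orbifold class contains
$-\tau\lambda(h)$ where the LG factor has $+\tau\theta(h_a)$.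

At $u=z$ the normalized Chern roots are $q_iz$, nonzero for $z\ne0$, so the Gysin factor and the
Chern roots of the fixed space cancel the Euler class. What remains is a product over the
coordinates of `thetaRatio`.

The two sides use different logarithms of the same characters: $\lambda\in[0,1)$ on one, arbitrary
rational $\theta_i$ on the other. This is harmless, since `thetaRatio` depends on both logarithms
only modulo $\mathbb Z$ (`thetaRatio_add_int`): the multipliers of $\theta$ under $y\mapsto y+1$ and
$y\mapsto y+\tau$ cancel in the ratio, up to a factor that the exponential absorbs. Finally, oddness
of $\theta$ in the numerator gives one sign per coordinate (`factor_eq_neg_thetaRatio`), hence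
$(-1)^n$. -/

theorem jacobiThetaOne_add_one (y τ : ℂ) : jacobiThetaOne (y + 1) τ = -jacobiThetaOne y τ := by
  have h : jacobiTheta₂ (y + 1 + 1 / 2 + τ / 2) τ = jacobiTheta₂ (y + 1 / 2 + τ / 2) τ := by
    rw [← jacobiTheta₂_add_left (y + 1 / 2 + τ / 2) τ]
    congr 1
    ring
  rw [jacobiThetaOne, jacobiThetaOne, h,
    show (Real.pi : ℂ) * Complex.I * (τ / 4 + (y + 1) + 1 / 2) =
      Real.pi * Complex.I * (τ / 4 + y + 1 / 2) + Real.pi * Complex.I by ring,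
    Complex.exp_add, Complex.exp_pi_mul_I]
  ring

/-- The multiplier is that of `jacobiTheta₂` combined with the change of the exponential prefactor;
the sign is $e^{-\pi i}$, produced by the shift of the argument by $1/2$. -/
theorem jacobiThetaOne_add_tau (y τ : ℂ) : jacobiThetaOne (y + τ) τ =
    -Complex.exp (-(Real.pi * Complex.I * (τ + 2 * y))) * jacobiThetaOne y τ := by
  have h : jacobiTheta₂ (y + τ + 1 / 2 + τ / 2) τ =
      Complex.exp (-Real.pi * Complex.I * (τ + 2 * (y + 1 / 2 + τ / 2))) *
        jacobiTheta₂ (y + 1 / 2 + τ / 2) τ := by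
    rw [← jacobiTheta₂_add_left']
    congr 1
    ring
  have e : Complex.exp (Real.pi * Complex.I * (τ / 4 + (y + τ) + 1 / 2)) *
      Complex.exp (-Real.pi * Complex.I * (τ + 2 * (y + 1 / 2 + τ / 2))) =
      -(Complex.exp (-(Real.pi * Complex.I * (τ + 2 * y))) *
        Complex.exp (Real.pi * Complex.I * (τ / 4 + y + 1 / 2))) := by
    rw [← Complex.exp_add, ← Complex.exp_add, ← Complex.exp_sub_pi_mul_I]
    congr 1
    ring
  rw [jacobiThetaOne, jacobiThetaOne, h]
  linear_combination -jacobiTheta₂ (y + 1 / 2 + τ / 2) τ * e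

/-- `jacobiTheta₂` is even, and its arguments at $y$ and $-y$ become, after a reflection and a shift
by $1$, two points that differ by $\tau$. The quasi-period multiplier then turns one prefactor into
minus the other. -/
theorem jacobiThetaOne_neg (y τ : ℂ) : jacobiThetaOne (-y) τ = -jacobiThetaOne y τ := by
  have h1 : jacobiTheta₂ (-y + 1 / 2 + τ / 2) τ = jacobiTheta₂ (y + 1 / 2 - τ / 2) τ := by
    rw [← jacobiTheta₂_neg_left, ← jacobiTheta₂_add_left]
    congr 1
    ring
  have h2 : jacobiTheta₂ (y + 1 / 2 + τ / 2) τ =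
      Complex.exp (-Real.pi * Complex.I * (τ + 2 * (y + 1 / 2 - τ / 2))) *
        jacobiTheta₂ (y + 1 / 2 - τ / 2) τ := by
    rw [← jacobiTheta₂_add_left']
    congr 1
    ring
  have e : Complex.exp (Real.pi * Complex.I * (τ / 4 + y + 1 / 2)) *
      Complex.exp (-Real.pi * Complex.I * (τ + 2 * (y + 1 / 2 - τ / 2))) =
      -Complex.exp (Real.pi * Complex.I * (τ / 4 + -y + 1 / 2)) := by
    rw [← Complex.exp_add, ← Complex.exp_sub_pi_mul_I]
    congr 1
    ring
  rw [jacobiThetaOne, jacobiThetaOne, h1, h2]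
  linear_combination -jacobiTheta₂ (y + 1 / 2 - τ / 2) τ * e

/-! ### Independence of the choice of logarithms -/

/-- The factor of the orbifold elliptic class that belongs to an eigenline with Chern root `2πi x`
and logarithms `B`, `A` of the two group elements. -/
noncomputable def thetaRatio (x z τ B A : ℂ) : ℂ :=
  jacobiThetaOne (x + B - τ * A - z) τ / jacobiThetaOne (x + B - τ * A) τ *
    Complex.exp (2 * Real.pi * Complex.I * A * z)

theorem thetaRatio_add_one_left (x z τ B A : ℂ) :
    thetaRatio x z τ (B + 1) A = thetaRatio x z τ B A := by
  rw [thetaRatio, thetaRatio, show x + (B + 1) - τ * A - z = x + B - τ * A - z + 1 by ring,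
    show x + (B + 1) - τ * A = x + B - τ * A + 1 by ring, jacobiThetaOne_add_one,
    jacobiThetaOne_add_one, neg_div_neg_eq]

/-- The quotient of the $\tau$-multipliers at $y-z$ and $y$ is $e^{2\pi iz}$, exactly the change of
the exponential factor. The multipliers never vanish, so the identity persists where a denominator
is zero and the quotient is read as $0$. -/
theorem thetaRatio_add_one_right (x z τ B A : ℂ) :
    thetaRatio x z τ B (A + 1) = thetaRatio x z τ B A := by
  set y := x + B - τ * (A + 1) with hy
  have e : Complex.exp (2 * Real.pi * Complex.I * (A + 1) * z) =
      Complex.exp (-(Real.pi * Complex.I * (τ + 2 * (y - z)))) /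
        Complex.exp (-(Real.pi * Complex.I * (τ + 2 * y))) *
        Complex.exp (2 * Real.pi * Complex.I * A * z) := by
    rw [← Complex.exp_sub, ← Complex.exp_add]
    congr 1
    ring
  rw [thetaRatio, thetaRatio, ← hy, show x + B - τ * A - z = y - z + τ by rw [hy]; ring,
    show x + B - τ * A = y + τ by rw [hy]; ring, jacobiThetaOne_add_tau, jacobiThetaOne_add_tau, e,
    mul_div_mul_comm, neg_div_neg_eq]
  ring

theorem thetaRatio_add_int (x z τ B A : ℂ) (b a : ℤ) :
    thetaRatio x z τ (B + b) (A + a) = thetaRatio x z τ B A := by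
  have hB : Function.Periodic (fun B => thetaRatio x z τ B (A + a)) 1 :=
    fun B => thetaRatio_add_one_left x z τ B _
  have hA : Function.Periodic (fun A => thetaRatio x z τ B A) 1 :=
    fun A => thetaRatio_add_one_right x z τ B A
  have h1 := hB.int_mul b B
  have h2 := hA.int_mul a A
  simp only [mul_one] at h1 h2
  exact h1.trans h2

theorem logChar_eq_add_int {c : ℂˣ} {r : ℝ}
    (h : (c : ℂ) = Complex.exp (2 * Real.pi * Complex.I * r)) : ∃ m : ℤ, logChar c = r + m := by
  have hc : (c : ℂ) = Complex.exp ((2 * Real.pi * r : ℝ) * Complex.I) := by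
    rw [h]
    congr 1
    push_cast
    ring
  -- Since `r` is real, `c` has norm $1$, so its polar form compares `arg c` with $2\pi r$ modulo
  -- $2\pi$.
  have harg := Complex.norm_mul_exp_arg_mul_I (c : ℂ)
  rw [hc, Complex.norm_exp_ofReal_mul_I, ← hc, Complex.ofReal_one, one_mul, hc,
    Complex.exp_eq_exp_iff_exists_int] at harg
  obtain ⟨m, hm⟩ := harg
  rw [← hc] at hm
  have hm' : Complex.arg c = 2 * Real.pi * r + m * (2 * Real.pi) := by
    have : (Complex.arg c : ℂ) = ((2 * Real.pi * r + m * (2 * Real.pi) : ℝ) : ℂ) := by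
      refine mul_right_cancel₀ Complex.I_ne_zero (hm.trans ?_)
      push_cast
      ring
    exact_mod_cast this
  refine ⟨m - ⌊Complex.arg c / (2 * Real.pi)⌋, ?_⟩
  have hpi := Real.pi_ne_zero
  rw [logChar, Int.fract]
  push_cast
  nth_rewrite 1 [hm']
  field_simp
  ring

/-! ### Matching the summands -/

namespace GlobalQuotient

variable {n : ℕ} {w : Fin n → ℕ} {D : ℕ} {k : ℤ}

/-- At the origin all Chern roots of the Gysin map and of the Euler class cancel. -/
theorem sector_div_eulerClass (Q : GlobalQuotient w D k) (g h : Fin n → ℂˣ) (u z : ℂ) (τ : ℍ)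
    (hu : ∀ i, Q.infChar u i ≠ 0) :
    Q.sector g h u z τ / ∏ i, Q.chernRoot u i =
      ∏ i, thetaRatio (Q.infChar u i) z τ (logChar (g i)) (logChar (h i)) := by
  classical
  have h2 : (2 * Real.pi * Complex.I : ℂ) ≠ 0 := Complex.two_pi_I_ne_zero
  have h0 : ∏ i, Q.chernRoot u i ≠ 0 :=
    Finset.prod_ne_zero_iff.2 fun i _ => mul_ne_zero h2 (hu i)
  rw [div_eq_iff h0, sector, ← mul_assoc, mul_comm (∏ i, thetaRatio _ _ _ _ _)]
  congr 1
  · rw [mul_comm]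
    -- The coordinates fixed by $g,h$ and the remaining ones together give the full Euler class.
    convert Finset.prod_filter_mul_prod_filter_not Finset.univ
      (fun i => logChar (g i) = 0 ∧ logChar (h i) = 0) (Q.chernRoot u)
  · refine Finset.prod_congr rfl fun i _ => ?_
    rw [thetaRatio, chernRoot, mul_div_cancel_left₀ _ h2]

end GlobalQuotient

namespace LGData

variable {n : ℕ} {G : Type*} [CommGroup G]

theorem factor_eq_neg_thetaRatio (L : LGData n G) (i : Fin n) (a b : G) (z : ℂ) (τ : ℍ) :
    L.factor i a b z τ =
      -thetaRatio ((L.q i : ℂ) * z) z τ (L.logR b i : ℂ) (-(L.logR a i : ℂ)) := by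
  rw [factor, thetaRatio,
    show (1 - (L.q i : ℂ)) * z - (L.logR b i : ℂ) - τ * (L.logR a i : ℂ) =
      -((L.q i : ℂ) * z + (L.logR b i : ℂ) - τ * (-(L.logR a i : ℂ)) - z) by ring,
    jacobiThetaOne_neg,
    show (L.q i : ℂ) * z + (L.logR b i : ℂ) + τ * (L.logR a i : ℂ) =
      (L.q i : ℂ) * z + (L.logR b i : ℂ) - τ * (-(L.logR a i : ℂ)) by ring,
    show -2 * (Real.pi : ℂ) * Complex.I * (L.logR a i : ℂ) * z =
      2 * Real.pi * Complex.I * (-(L.logR a i : ℂ)) * z by ring]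
  ring

/-- Replaces the normalized logarithms by the given rational ones; for the inverse element,
$-\theta_i(a)$ is a logarithm. -/
theorem thetaRatio_logChar (L : LGData n G) (i : Fin n) (a b : G) (x z : ℂ) (τ : ℍ) :
    thetaRatio x z τ (logChar (L.R b i)) (logChar (L.R a⁻¹ i)) =
      thetaRatio x z τ (L.logR b i : ℂ) (-(L.logR a i : ℂ)) := by
  obtain ⟨m, hm⟩ := logChar_eq_add_int (c := L.R b i) (r := (L.logR b i : ℝ))
    (by rw [L.exp_logR]; simp)
  obtain ⟨l, hl⟩ := logChar_eq_add_int (c := L.R a⁻¹ i) (r := -(L.logR a i : ℝ)) (by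
    rw [map_inv, Pi.inv_apply, Units.val_inv_eq_inv_val, L.exp_logR, ← Complex.exp_neg]
    simp)
  rw [hm, hl, ← thetaRatio_add_int x z τ (L.logR b i : ℂ) (-(L.logR a i : ℂ)) m l]
  push_cast
  rfl

theorem infChar_presentation (L : LGData n G) {k : ℤ} (hk : k < 0) (u : ℂ) (i : Fin n) :
    (L.presentation hk).infChar u i = (L.q i : ℂ) * u := by
  simp [GlobalQuotient.infChar, presentation, q]

end LGData

/-! ### Comparison of the two genera -/

theorem mainTheorem7 {n : ℕ} {G : Type*} [CommGroup G] (L : LGData n G) {k : ℤ} (hk : k < 0)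
    (H : Subgroup G) (hinj : Set.InjOn L.R H) (hH : H.map L.R = Subgroup.zpowers L.J)
    (z : ℂ) (hz : z ≠ 0) (τ : ℍ) :
    (L.presentation hk).ellipticGenus z τ = (-1) ^ n * L.genus H z τ := by
  set Q := L.presentation hk with hQ
  have hΓ : H.map L.R = Q.Γ := hH
  let f : H → Q.Γ := fun h => ⟨L.R h, hΓ ▸ Subgroup.mem_map_of_mem L.R h.2⟩
  have hf : Function.Bijective f := by
    refine ⟨fun a b hab => Subtype.ext (hinj a.2 b.2 (congrArg Subtype.val hab)), ?_⟩
    rintro ⟨g, hg⟩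
    obtain ⟨h, hh, rfl⟩ := hΓ.symm ▸ hg
    exact ⟨⟨h, hh⟩, rfl⟩
  let e : H ≃ Q.Γ := Equiv.ofBijective f hf
  have := Q.finite
  have := Finite.of_equiv _ e.symm
  have := Fintype.ofFinite H
  -- The Euler class is invertible at $u=z$ because $z\ne0$ and all weights are positive.
  have hu : ∀ i, Q.infChar z i ≠ 0 := by
    intro i
    rw [hQ, L.infChar_presentation hk]
    have h1 : L.q i ≠ 0 :=
      div_ne_zero (by exact_mod_cast (L.w_pos i).ne') (by exact_mod_cast L.D_pos.ne')
    exact mul_ne_zero (by exact_mod_cast h1) hz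
  have key : ∀ a b : H, Q.sector (e b).1 (e a⁻¹).1 z z τ / ∏ i, Q.chernRoot z i =
      (-1) ^ n * ∏ i, L.factor i a.1 b.1 z τ := by
    intro a b
    rw [Q.sector_div_eulerClass _ _ _ _ _ hu]
    simp only [L.factor_eq_neg_thetaRatio, Finset.prod_neg, Finset.card_univ, Fintype.card_fin]
    -- The sign $(-1)^n$ from oddness cancels the one in the claim.
    rw [← mul_assoc, ← mul_pow, neg_one_mul, neg_neg, one_pow, one_mul]
    refine Finset.prod_congr rfl fun i _ => ?_
    rw [show Q.infChar z i = _ from L.infChar_presentation hk z i]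
    exact L.thetaRatio_logChar i a.1 b.1 _ z τ
  rw [GlobalQuotient.ellipticGenus, GlobalQuotient.originContribution, LGData.genus,
    ← Nat.card_congr e, mul_left_comm]
  congr 1
  -- The sum over $g$ is reindexed by $b\mapsto R(b)$, the one over $h$ by $a\mapsto R(a^{-1})$. The
  -- outer sum then runs over $b$, so the order of summation is exchanged below.
  rw [← finsum_comp_equiv e]
  simp only [← finsum_comp_equiv ((Equiv.inv H).trans e), Equiv.trans_apply, Equiv.inv_apply,
    key, finsum_eq_sum_of_fintype]
  rw [Finset.sum_comm]
  simp only [Finset.mul_sum]
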